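/- All graphs are finite. A cactus is a connected simple graph in which any two distinct cycles are edge-disjoint. An orientation of a simple graph $G$ is a digraph obtained by replacing each edge $\{u,v\}$ of $G$ with exactly one of the arcs $uv$, $vu$. For a vertex $x$ of a digraph $D$, let $\sigma_D(x)=d_D^+(x)-d_D^-(x)$ be its balanced degree (outdegree minus indegree). A digraph $D$ is strong locally irregular if $\sigma_D(x)\neq\sigma_D(y)$ for every arc $xy$ of $D$. The strong locally irregular chromatic index $\operatorname{slir}(D)$ is the minimum number of colors in an arc coloring of $D$ in which every color class induces a strong locally irregular digraph. **Theorem.** Let $G$ be a cactus whose cycles are pairwise vertex-disjoint, and let $D$ be an orientation of $G$. Then $\operatorname{slir}(D)\le 2$. -/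

import Mathlib

noncomputable section

namespace SimpleGraph

variable {V : Type*}

/-- A cactus: a connected graph in which any two distinct cycles (regarded as subgraphs) are
edge-disjoint. -/
def IsCactus (G : SimpleGraph V) : Prop :=
  G.Connected ∧
    ∀ ⦃u v : V⦄ (p : G.Walk u u) (q : G.Walk v v), p.IsCycle → q.IsCycle →
      p.toSubgraph ≠ q.toSubgraph → Disjoint p.toSubgraph.edgeSet q.toSubgraph.edgeSet

/-- Any two distinct cycles (regarded as subgraphs) have no vertex in common. -/
def HasVertexDisjointCycles (G : SimpleGraph V) : Prop :=
  ∀ ⦃u v : V⦄ (p : G.Walk u u) (q : G.Walk v v), p.IsCycle → q.IsCycle →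
    p.toSubgraph ≠ q.toSubgraph → Disjoint p.toSubgraph.verts q.toSubgraph.verts

end SimpleGraph

namespace Digraph

variable {V : Type*}

/-- `D` is obtained from the simple graph `G` by replacing each edge with exactly one of the two
arcs joining its ends. -/
def IsOrientationOf (D : Digraph V) (G : SimpleGraph V) : Prop :=
  (∀ u v : V, G.Adj u v ↔ D.Adj u v ∨ D.Adj v u) ∧ ∀ u v : V, D.Adj u v → ¬ D.Adj v u

/-- The number of arcs leaving `v`; used for digraphs with finitely many vertices. -/
def outDeg (D : Digraph V) (v : V) : ℕ := {w : V | D.Adj v w}.ncard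

/-- The number of arcs entering `v`; used for digraphs with finitely many vertices. -/
def inDeg (D : Digraph V) (v : V) : ℕ := {w : V | D.Adj w v}.ncard

/-- The balanced degree `σ(v) = d⁺(v) - d⁻(v)`. -/
def balancedDegree (D : Digraph V) (v : V) : ℤ := (D.outDeg v : ℤ) - (D.inDeg v : ℤ)

/-- The two ends of every arc have different balanced degrees. -/
def IsStrongLocallyIrregular (D : Digraph V) : Prop :=
  ∀ u v : V, D.Adj u v → D.balancedDegree u ≠ D.balancedDegree v

/-- The type of arcs of `D`. -/
abbrev Arc (D : Digraph V) : Type _ := {a : V × V // D.Adj a.1 a.2}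

/-- The subdigraph formed by the arcs with color `i`. (Vertices that are not on such an arc are
kept as isolated vertices; they affect neither the degrees of the others nor any arc.) -/
def colorClass (D : Digraph V) {α : Type*} (c : D.Arc → α) (i : α) : Digraph V where
  Adj u v := ∃ h : D.Adj u v, c ⟨(u, v), h⟩ = i

/-- An arc coloring all of whose color classes are strong locally irregular. -/
def IsStrongLocallyIrregularColoring (D : Digraph V) {α : Type*} (c : D.Arc → α) : Prop :=
  ∀ i : α, (D.colorClass c i).IsStrongLocallyIrregular

/-- The strong locally irregular chromatic index: the least number of colors in a strong locally
irregular coloring (it would be `⊤` if no such coloring with finitely many colors existed). -/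
def slir (D : Digraph V) : ℕ∞ :=
  ⨅ k ∈ {k : ℕ | ∃ c : D.Arc → Fin k, D.IsStrongLocallyIrregularColoring c}, (k : ℕ∞)

end Digraph

end

namespace SimpleGraph

variable {V : Type*} {G : SimpleGraph V}

/-! If `G` is bipartite, color each arc by the side of its head: within a class every arc runs from
a source to a sink, so `σ` is positive at its tail and negative at its head. In general, delete one
arc from each odd cycle and 2-color the bipartite rest. As cycles are vertex-disjoint, the
monochromatic arcs form a matching. Such an arc `xy` has `σ(x) = 1 - d⁻(x)` and `σ(y) = -d⁻(y)` in
its class, so it must satisfy `d⁻(x) ≠ d⁻(y) + 1`. Every odd cycle has such an arc, since otherwise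
the parity of `d⁻` would alternate around it. -/

/-- The odd cycles of a graph, regarded as subgraphs. -/
def oddCycles (G : SimpleGraph V) : Set G.Subgraph :=
  {H | ∃ (u : V) (p : G.Walk u u), p.IsCycle ∧ ¬ Even p.length ∧ p.toSubgraph = H}

/-- In a graph without odd cycles, every walk can be replaced by a path of the same parity. -/
theorem Walk.exists_isPath_even_length_iff
    (hG : ∀ ⦃v : V⦄ (q : G.Walk v v), q.IsCycle → Even q.length) {u v : V} (p : G.Walk u v) :
    ∃ q : G.Walk u v, q.IsPath ∧ (Even q.length ↔ Even p.length) := by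
  classical
  induction p with
  | nil => exact ⟨.nil, by simp, Iff.rfl⟩
  | @cons u w v h p ih =>
    obtain ⟨q, hq, hqp⟩ := ih
    by_cases hu : u ∈ q.support
    · refine ⟨q.dropUntil u hu, hq.dropUntil hu, ?_⟩
      -- The edge `uw` either closes this initial segment into a cycle, even by `hG`, or is itself
      -- the whole segment.
      have hodd : ¬ Even (q.takeUntil u hu).length := by
        by_cases he : s(u, w) ∈ (q.takeUntil u hu).edges
        · rw [Sym2.eq_swap] at he
          rw [(hq.takeUntil hu).length_eq_one_of_mem_edges he]
          decide
        · have := hG _ ((q.takeUntil u hu).cons_isCycle_iff h |>.2 ⟨hq.takeUntil hu, he⟩)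
          simpa [Nat.even_add_one] using this
      have hlen := congrArg Walk.length (q.take_spec hu)
      rw [Walk.length_append] at hlen
      rw [Walk.length_cons, Nat.even_add_one, ← hqp, ← hlen, Nat.even_add]
      tauto
    · refine ⟨.cons h q, hq.cons hu, ?_⟩
      simp [Nat.even_add_one, hqp]

/-- A graph without odd cycles is bipartite. -/
theorem colorable_two_of_forall_isCycle_even
    (hG : ∀ ⦃v : V⦄ (q : G.Walk v v), q.IsCycle → Even q.length) : G.Colorable 2 := by
  refine two_colorable_iff_forall_loop_even.2 fun u p => ?_
  obtain ⟨q, hq, hqp⟩ := p.exists_isPath_even_length_iff hG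
  rw [← hqp, Walk.length_eq_zero_iff.2 (Walk.isPath_iff_nil.1 hq)]
  simp

/-- A function whose parity changes along every edge of a walk tells the parity of the length. -/
theorem Walk.even_length_iff_of_forall_edges (f : V → ℕ) {u v : V} (p : G.Walk u v)
    (hp : ∀ x y, s(x, y) ∈ p.edges → (Even (f x) ↔ ¬ Even (f y))) :
    Even p.length ↔ (Even (f u) ↔ Even (f v)) := by
  induction p with
  | nil => simp
  | @cons u w v h p ih =>
    have h1 := hp u w (by simp)
    have h2 := ih fun x y hxy => hp x y (by simp [hxy])
    rw [Walk.length_cons, Nat.even_add_one, h2]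
    tauto

end SimpleGraph

namespace Digraph

variable {V : Type*} {D : Digraph V} {G : SimpleGraph V}

/-- An odd closed walk has an arc `xy` with `d⁻(x) ≠ d⁻(y) + 1`. -/
theorem IsOrientationOf.exists_adj_inDeg_ne (hD : D.IsOrientationOf G) {u : V} (p : G.Walk u u)
    (hp : ¬ Even p.length) :
    ∃ a : V × V, D.Adj a.1 a.2 ∧ s(a.1, a.2) ∈ p.edges ∧ D.inDeg a.1 ≠ D.inDeg a.2 + 1 := by
  by_contra! hcon
  refine hp ((p.even_length_iff_of_forall_edges D.inDeg fun x y hxy => ?_).2 Iff.rfl)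
  rcases (hD.1 x y).1 (p.adj_of_mem_edges hxy) with h | h
  · rw [hcon (x, y) h hxy, Nat.even_add_one]
  · rw [hcon (y, x) h (by rwa [Sym2.eq_swap]), Nat.even_add_one, not_not]

/-- A two-coloring of the vertices in which no two monochromatic arcs share a tail or are
consecutive, and every monochromatic arc `xy` satisfies `d⁻(x) ≠ d⁻(y) + 1`, gives a strong locally irregular coloring: color each arc by the color opposite
to that of its head. -/
theorem isStrongLocallyIrregularColoring_of_vertex_coloring [Finite V] (f : V → Fin 2)
    (hout : ∀ u v w, D.Adj u v → D.Adj u w → f u = f v → f u = f w → v = w)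
    (hpath : ∀ u v w, D.Adj u v → D.Adj v w → f u = f v → f v ≠ f w)
    (hdeg : ∀ u v, D.Adj u v → f u = f v → D.inDeg u ≠ D.inDeg v + 1) :
    D.IsStrongLocallyIrregularColoring fun a : D.Arc => 1 - f a.1.2 := by
  rintro i u v ⟨huv, rfl⟩
  set E := D.colorClass (fun a : D.Arc => 1 - f a.1.2) (1 - f v) with hE
  have hadj : ∀ x y, E.Adj x y ↔ D.Adj x y ∧ f y = f v := by
    intro x y
    simp [hE, colorClass]
  have hin : ∀ x, f x = f v → E.inDeg x = D.inDeg x := by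
    intro x hx
    simp [inDeg, hadj, hx]
  have hin0 : ∀ x, f x ≠ f v → E.inDeg x = 0 := by
    intro x hx
    simp [inDeg, hadj, hx]
  have hout1 : ∀ x, f x = f v → E.outDeg x ≤ 1 := by
    intro x hx
    refine (Set.ncard_le_one_iff (Set.toFinite _)).2 fun {a b} ha hb => ?_
    obtain ⟨ha, hav⟩ := (hadj _ _).1 ha
    obtain ⟨hb, hbv⟩ := (hadj _ _).1 hb
    exact hout x a b ha hb (hx.trans hav.symm) (hx.trans hbv.symm)
  have houtpos : 0 < E.outDeg u :=
    (Set.ncard_pos (Set.toFinite _)).2 ⟨v, (hadj u v).2 ⟨huv, rfl⟩⟩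
  have hv := hin v rfl
  have hv1 := hout1 v rfl
  unfold balancedDegree
  by_cases hmono : f u = f v
  · have hvout : E.outDeg v = 0 := by
      rw [outDeg, Set.ncard_eq_zero (Set.toFinite _), Set.eq_empty_iff_forall_notMem]
      intro w hw
      obtain ⟨hvw, hw⟩ := (hadj v w).1 hw
      exact hpath u v w huv hvw hmono hw.symm
    have hu := hin u hmono
    have hu1 := hout1 u hmono
    have := hdeg u v huv hmono
    omega
  · have hu := hin0 u hmono
    have hvpos : 0 < D.inDeg v := (Set.ncard_pos (Set.toFinite _)).2 ⟨u, huv⟩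
    -- The tail has `σ > 0`, while the head has at most one out-arc and at least one in-arc, so `σ ≤
    -- 0`.
    omega

/-- An orientation of a graph with vertex-disjoint cycles has a two-coloring of its vertices in
which no two monochromatic arcs share a tail or are consecutive, and every monochromatic arc `xy`
satisfies `d⁻(x) ≠ d⁻(y) + 1`. -/
theorem IsOrientationOf.exists_vertex_coloring (hdisj : G.HasVertexDisjointCycles)
    (hD : D.IsOrientationOf G) :
    ∃ f : V → Fin 2,
      (∀ u v w, D.Adj u v → D.Adj u w → f u = f v → f u = f w → v = w) ∧
      (∀ u v w, D.Adj u v → D.Adj v w → f u = f v → f v ≠ f w) ∧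
      ∀ u v, D.Adj u v → f u = f v → D.inDeg u ≠ D.inDeg v + 1 := by
  have hchoice : ∀ H : G.oddCycles,
      ∃ a : V × V, D.Adj a.1 a.2 ∧ H.1.Adj a.1 a.2 ∧ D.inDeg a.1 ≠ D.inDeg a.2 + 1 := by
    rintro ⟨_, u, p, -, hp, rfl⟩
    obtain ⟨a, ha, hap, hdeg⟩ := hD.exists_adj_inDeg_ne p hp
    exact ⟨a, ha, p.adj_toSubgraph_iff_mem_edges.2 hap, hdeg⟩
  choose t htD htH htdeg using hchoice
  have huniq : ∀ (H H' : G.oddCycles) (x : V), x ∈ H.1.verts → x ∈ H'.1.verts → H = H' := by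
    rintro ⟨_, u, p, hp, _, rfl⟩ ⟨_, v, q, hq, _, rfl⟩ x hx hx'
    by_contra hne
    exact (hdisj p q hp hq fun h => hne (Subtype.ext h)).le_bot ⟨hx, hx'⟩
  let s : Set (Sym2 V) := Set.range fun H => s((t H).1, (t H).2)
  have hcol : (G.deleteEdges s).Colorable 2 := by
    refine SimpleGraph.colorable_two_of_forall_isCycle_even fun v q hq => ?_
    by_contra hodd
    have hle : G.deleteEdges s ≤ G := G.deleteEdges_le s
    -- A surviving odd cycle is an odd cycle of `G`, yet its chosen edge was deleted.
    let H : G.oddCycles := ⟨_, v, q.mapLe hle, hq.mapLe hle, by simpa using hodd, rfl⟩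
    have hmem := SimpleGraph.Walk.adj_toSubgraph_iff_mem_edges.1 (htH H)
    rw [SimpleGraph.Walk.edges_mapLe_eq_edges] at hmem
    have := q.edges_subset_edgeSet hmem
    rw [SimpleGraph.edgeSet_deleteEdges] at this
    exact this.2 ⟨H, rfl⟩
  obtain ⟨f⟩ := hcol
  have hmono : ∀ u v, D.Adj u v → f u = f v → ∃ H, t H = (u, v) := by
    intro u v huv hf
    have hnot : ¬ (G.deleteEdges s).Adj u v := fun h => f.valid h hf
    rw [SimpleGraph.deleteEdges_adj, not_and, not_not] at hnot
    obtain ⟨H, hH⟩ := hnot ((hD.1 u v).2 (.inl huv))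
    refine ⟨H, ?_⟩
    rcases Sym2.eq_iff.1 hH with ⟨h1, h2⟩ | ⟨h1, h2⟩
    · exact Prod.ext h1 h2
    · have := htD H
      rw [h1, h2] at this
      exact absurd this (hD.2 u v huv)
  have hfst : ∀ {H : G.oddCycles} {u v : V}, t H = (u, v) → u ∈ H.1.verts := fun {H u v} h => by
    simpa [h] using H.1.edge_vert (htH H)
  have hsnd : ∀ {H : G.oddCycles} {u v : V}, t H = (u, v) → v ∈ H.1.verts := fun {H u v} h => by
    simpa [h] using H.1.edge_vert (htH H).symm
  refine ⟨f, fun u v w huv huw hv hw => ?_, fun u v w huv hvw hu hv => ?_, fun u v huv hu => ?_⟩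
  · obtain ⟨H, hH⟩ := hmono u v huv hv
    obtain ⟨H', hH'⟩ := hmono u w huw hw
    obtain rfl := huniq H H' u (hfst hH) (hfst hH')
    exact (Prod.ext_iff.1 (hH.symm.trans hH')).2
  · obtain ⟨H, hH⟩ := hmono u v huv hu
    obtain ⟨H', hH'⟩ := hmono v w hvw hv
    obtain rfl := huniq H H' v (hsnd hH) (hfst hH')
    obtain rfl : u = v := (Prod.ext_iff.1 (hH.symm.trans hH')).1
    exact hD.2 _ _ huv huv
  · obtain ⟨H, hH⟩ := hmono u v huv hu
    simpa [hH] using htdeg H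

end Digraph

theorem mainTheorem7 {V : Type*} [Finite V] (G : SimpleGraph V) (hG : G.IsCactus)
    (hdisj : G.HasVertexDisjointCycles) (D : Digraph V) (hD : D.IsOrientationOf G) :
    D.slir ≤ 2 := by
  obtain ⟨f, hout, hpath, hdeg⟩ := hD.exists_vertex_coloring hdisj
  exact iInf₂_le_of_le 2
    ⟨_, Digraph.isStrongLocallyIrregularColoring_of_vertex_coloring f hout hpath hdeg⟩ le_rfl
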